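/- Let $\mathbb N=\{1,2,3,\dots\}$, let $d\ge 1$ and put $s_d(n)=d(n-1)+1$. Let $H_{d,1}(x)=\sum_{n\ge 1}\frac{x^{s_d(n)}}{s_d(n)!}\in\mathbb Q[[x]]$ (the hyperbolic function of order $d$ of the first kind). Definitions. A *linearly ordered phylogenetic tree with $N$ leaves* is a rooted tree in which the children of every vertex are linearly ordered from left to right, no vertex has exactly one child, and the $N$ leaves (vertices without children) are labeled bijectively by $\{1,\dots,N\}$. The degree $d(v)$ of a vertex $v$ is its number of children, and $\ell_{\max}(v)$ is the largest label of a leaf descended from $v$ (or equal to $v$). The tree is *increasingly ordered* if $\ell_{\max}$ increases from left to right along the children of each vertex. A vertex $v$ has *$(d+1)$-left-odd ancestry* if there is a path $v_1,\dots,v_k=v$ with $k$ even such that, for $1\le i<k$, $d(v_i)=d+1$ and $v_{i+1}$ is the left-most child of $v_i$, and $v_1$ is not the left-most child of a vertex of degree $d+1$. For $R\subseteq\mathbb N$ let $a(R)$ be the set of left endpoints other than $1$, and $b(R)$ the set of right endpoints, of the maximal intervals of $R$. If $R$ has no exposed odds (that is, $1\in R$ implies $2\in R$, and $n-1,n+1\in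 R$ for every odd $n\ge 3$ in $R$), a tree is *$R(d)$-good* if every non-leaf vertex $v$ satisfies: $d(v)=d+1$ or $d(v)=s_d(a)$ for some $a\in a(R)$, when $v$ does not have $(d+1)$-left-odd ancestry; and $d(v)=s_d(b)$ for some $b\in b(R)$, when it does. Let $\Pi_N^{1,d}$ be the poset of partitions of $\{1,\dots,N\}$ all of whose parts have size congruent to $1$ modulo $d$, ordered by refinement, with least element $\hat 0$ the partition into singletons. For a finite ranked poset $P$ with least element $\hat 0$ and Möbius function $\mu$, $w_k(P)=\sum_{x\,:\,\operatorname{rank}(x)=k}\mu(\hat 0,x)$ is its $k$-th Whitney number of the first kind. **Corollary.** The series $H_{d,1}$ has a unique compositional inverse $h_{d,1}\in x\,\mathbb Q[[x]]$, i.e. $h_{d,1}(H_{d,1}(x))=H_{d,1}(h_{d,1}(x))=x$ as formal power series. It can be written in the form $$h_{d,1}(x)=\sum_{n\ge 1}(-1)^{n-1}h_n\frac{x^{d(n-1)+1}}{(d(n-1)+1)!},$$ and for the coefficients $h_n$ in this form and every $n\ge 1$: (a) $h_n$ is the (finite) number of increasingly ordered phylogenetic trees with $d(n-1)+1$ leaves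 that are $\mathbb N(d)$-good; moreover such an increasingly ordered tree is $\mathbb N(d)$-good if and only if all its vertices have degree $d+1$ or $0$ and all left-most children have degree $0$. (b) The poset $\Pi_{d(n-1)+1}^{1,d}$ is ranked, and $w_{n-1}\bigl(\Pi_{d(n-1)+1}^{1,d}\bigr)=(-1)^{n-1}h_n$. -/

import Mathlib

open scoped PowerSeries

/-! ### Formal power series -/

/-- The map `s_d(n) = d (n - 1) + 1`, used for `n ≥ 1`. -/
def stretch (d n : ℕ) : ℕ := d * (n - 1) + 1

/-- The formal power series `∑_{n ≥ 1} c n * x ^ s_d(n) / s_d(n)!`, for `d ≥ 1`.  In the coefficient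
of `x ^ m` only indices `n ≤ m` can occur, because `n ≤ s_d(n)`. -/
noncomputable def expSeriesAlong (d : ℕ) (c : ℕ → ℚ) : ℚ⟦X⟧ :=
  PowerSeries.mk fun m =>
    ∑ n ∈ Finset.Icc 1 m, if stretch d n = m then c n / (Nat.factorial m : ℚ) else 0

/-- The hyperbolic function of order `d` of the first kind, `H_{d,1}`, as a power series. -/
noncomputable def hyperbolicSeries (d : ℕ) : ℚ⟦X⟧ := expSeriesAlong d fun _ => 1

/-- `g` is a compositional inverse of `f`: both series have no constant term (so both composites
make sense), and `f(g(x)) = x` and `g(f(x)) = x`.  Here `PowerSeries.subst g f` is `f(g(x))`. -/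
def IsCompInverse (f g : ℚ⟦X⟧) : Prop :=
  PowerSeries.constantCoeff f = 0 ∧ PowerSeries.constantCoeff g = 0 ∧
    PowerSeries.subst g f = (PowerSeries.X : ℚ⟦X⟧) ∧
    PowerSeries.subst f g = (PowerSeries.X : ℚ⟦X⟧)

/-! ### Trees -/

/-- Rooted trees with ordered children (`0 : Fin k` is the left-most child) and with leaves
labeled by natural numbers. -/
inductive PlaneTree : Type
  | leaf (label : ℕ) : PlaneTree
  | node (k : ℕ) (children : Fin k → PlaneTree) : PlaneTree

namespace PlaneTree

/-- The multiset of all leaf labels. -/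
def labels : PlaneTree → Multiset ℕ
  | leaf a => {a}
  | node _ c => ∑ i, (c i).labels

/-- The label `ℓ_max` of the root: the maximum of the labels of the leaves of the tree. -/
def maxLabel (t : PlaneTree) : ℕ := t.labels.sup

/-- Every non-leaf vertex has at least two children.  (This also says that the vertices without
children are exactly those made by `leaf`.) -/
def NoUnary : PlaneTree → Prop
  | leaf _ => True
  | node k c => 2 ≤ k ∧ ∀ i, (c i).NoUnary

/-- Linearly ordered phylogenetic tree with `N` leaves: no vertex has degree one, and the leaf
labeling is injective with range `{1, …, N}`. -/
def IsPhylogenetic (N : ℕ) (t : PlaneTree) : Prop :=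
  t.NoUnary ∧ t.labels = (Finset.Icc 1 N).val

/-- In each set of siblings `ℓ_max` increases from left to right. -/
def IncreasinglyOrdered : PlaneTree → Prop
  | leaf _ => True
  | node _ c => (StrictMono fun i => (c i).maxLabel) ∧ ∀ i, (c i).IncreasinglyOrdered

/-- A vertex is addressed by the list of child indices on the path from the root to it (`[]` is the
root, `p ++ [0]` is the left-most child of `p`).  This is the subtree rooted at the address, if the
address is that of a vertex. -/
def subtreeAt : PlaneTree → List ℕ → Option PlaneTree
  | t, [] => some t
  | leaf _, _ :: _ => none
  | node k c, i :: p => if h : i < k then (c ⟨i, h⟩).subtreeAt p else none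

/-- `p` is the address of a vertex of `t`. -/
def IsVertex (t : PlaneTree) (p : List ℕ) : Prop := (t.subtreeAt p).isSome

/-- The number of children of the root. -/
def rootDegree : PlaneTree → ℕ
  | leaf _ => 0
  | node k _ => k

/-- The (down-)degree of the vertex at address `p`. -/
def degree (t : PlaneTree) (p : List ℕ) : ℕ := ((t.subtreeAt p).map rootDegree).getD 0

/-- The vertex `v` has `s`-left-odd ancestry: there is an ancestor `v₁ = p` and a path
`v₁, …, v_k = v` with `k` even, `v_{i+1}` the left-most child of `v_i` and `v_i` of degree `s` for
`1 ≤ i < k`, such that `v₁` is not the left-most child of a vertex of degree `s`.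
The vertex `v_{i+1}` is `p` followed by `i` zeros. -/
def HasLeftOddAncestry (s : ℕ) (t : PlaneTree) (v : List ℕ) : Prop :=
  ∃ (p : List ℕ) (k : ℕ), 1 ≤ k ∧ Even k ∧ v = p ++ List.replicate (k - 1) 0 ∧
    (∀ i, i + 1 < k → t.degree (p ++ List.replicate i 0) = s) ∧
    ∀ w, p = w ++ [0] → t.degree w ≠ s

end PlaneTree

/-- `a(R)`: the left endpoints, except `1`, of the maximal intervals of `R ⊆ {1, 2, …}`. -/
def leftEndpoints (R : Set ℕ) : Set ℕ := {x | x ∈ R ∧ x ≠ 1 ∧ x - 1 ∉ R}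

/-- `b(R)`: the right endpoints of the maximal intervals of `R ⊆ {1, 2, …}`. -/
def rightEndpoints (R : Set ℕ) : Set ℕ := {x | x ∈ R ∧ x + 1 ∉ R}

namespace PlaneTree

/-- `R(d)`-good trees, for `R ⊆ {1, 2, …}` with no exposed odds. -/
def IsGood (R : Set ℕ) (d : ℕ) (t : PlaneTree) : Prop :=
  ∀ v, t.IsVertex v →
    (¬ t.HasLeftOddAncestry (stretch d 2) v →
      t.degree v = 0 ∨ t.degree v = stretch d 2 ∨
        ∃ a ∈ leftEndpoints R, t.degree v = stretch d a) ∧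
    (t.HasLeftOddAncestry (stretch d 2) v →
      t.degree v = 0 ∨ ∃ b ∈ rightEndpoints R, t.degree v = stretch d b)

/-- Increasingly ordered phylogenetic trees with `N` leaves. -/
def increasingTrees (N : ℕ) : Set PlaneTree :=
  {t | t.IsPhylogenetic N ∧ t.IncreasinglyOrdered}

end PlaneTree

/-! ### Whitney numbers -/

/-- A poset in which every covering step raises the height by exactly one, so that
`Order.height` is the rank function. -/
def IsRankedPoset (P : Type*) [PartialOrder P] : Prop :=
  ∀ x y : P, x ⋖ y → Order.height y = Order.height x + 1

open Classical in
/-- The `k`-th Whitney number of the first kind of a finite ranked poset with least element `⊥`: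
the sum of `μ(⊥, x)` over the elements `x` of rank `k`. -/
noncomputable def whitneyFirst (P : Type*) [PartialOrder P] [OrderBot P] [Finite P] (k : ℕ) : ℤ :=
  letI : Fintype P := Fintype.ofFinite P
  letI : LocallyFiniteOrder P := Fintype.toLocallyFiniteOrder
  ∑ x : P with Order.height x = (k : ℕ∞), IncidenceAlgebra.mu ℤ (⊥ : P) x

/-- The poset `Π_N^{1,d}` of partitions of `{1, …, N}` all of whose parts have size congruent to `1`
modulo `d`, ordered by refinement (finer partitions are smaller). -/
abbrev OneModPartition (d N : ℕ) : Type :=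
  {P : Finpartition (Finset.Icc 1 N) // ∀ B ∈ P.parts, B.card ≡ 1 [MOD d]}

/-- The least element is the partition into singletons. -/
instance OneModPartition.instOrderBot (d N : ℕ) : OrderBot (OneModPartition d N) :=
  Subtype.orderBot (by
    intro B hB
    obtain ⟨a, -, rfl⟩ := Finpartition.mem_bot_iff.mp hB
    rw [Finset.card_singleton])

/-! Write δ₀, δ₁ for `Pi.single 0 1`, `Pi.single 1 1`. Let f satisfy f 0 = 0, put L = `blockConv f`,
and let F be the exponential generating function of f. Then L^k δ₀ has generating function F^k / k!
(`egf_iterate_blockConv`), and at #S it is the sum of ∏ f(#B) over the partitions of S into k blocks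
(`Finpartition.sum_blockWeight_card_eq`). Everything follows from one equation, f = δ₁ - L^d δ₁.
Since L δ₀ = f, it gives L^(dj+1) δ₀ = L^(dj) δ₁ - L^(d(j+1)) δ₁, and the sum over j telescopes to
δ₁ (`sum_iterate_blockConv`).

Read through generating functions, this says H(F) = x, so F is the inverse series
(`subst_egf_hyperbolicSeries`). Read through set partitions, with f supported on sizes 1 mod d, it
says that the block weights of all partitions of S sum to 1 if #S = 1 and to 0 for every other size
congruent to 1 mod d. Multiplying over the blocks of π gives the recursion that defines the Möbius
function, so μ(⊥, π) = ∏ f(#B) (`OneModPartition.mu_bot_eq`). The only element of top rank is the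
one-block partition, where this product is f(N).

Trees supply f. Deleting the root of an increasingly ordered tree whose left-most children are all
leaves leaves a leaf followed by d such trees. These are peeled off from the right, each being the
one that holds the largest remaining label, so the counts t satisfy t = δ₁ + (`blockConv t`)^d δ₁
(`PlaneTree.treeCount_eq`). Signing by the number of internal vertices turns this into the equation
for f (`PlaneTree.signedTreeCount_eq`), and `PlaneTree.isGood_Ici_one_iff` shows that these trees
are the good ones. -/

/-! ### Binomial convolution along a distinguished block -/

/-- If `f` and `u` count structures on finite sets, then `blockConv f u` counts pairs of an
`f`-structure on a block containing a fixed element and a `u`-structure on the complement. -/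
def blockConv (f u : ℕ → ℚ) : ℕ → ℚ
  | 0 => 0
  | n + 1 => ∑ j ∈ Finset.range (n + 1), (n.choose j : ℚ) * (f (j + 1) * u (n - j))

/-- Removing `a` from `B` leaves an arbitrary subset of the other elements. The choice of `a` is
free: for forests it is the largest label, for set partitions any element. -/
theorem sum_blocks_eq_blockConv {α : Type*} [DecidableEq α] (f u : ℕ → ℚ) {S : Finset α} {a : α}
    (ha : a ∈ S) :
    ∑ B ∈ S.powerset with a ∈ B, f B.card * u (S \ B).card = blockConv f u S.card := by
  obtain ⟨n, hn⟩ : ∃ n, S.card = n + 1 := ⟨S.card - 1, by have := Finset.card_pos.2 ⟨a, ha⟩; omega⟩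
  have hc : (S.erase a).card = n := by rw [Finset.card_erase_of_mem ha]; omega
  have key := Finset.sum_powerset_apply_card (x := S.erase a) (fun j => f (j + 1) * u (n - j))
  rw [hc] at key
  rw [hn, blockConv]
  simp only [nsmul_eq_mul] at key
  rw [← key]
  symm
  refine Finset.sum_bij (fun C _ => insert a C) ?_ ?_ ?_ ?_
  · intro C hC
    simp only [Finset.mem_powerset] at hC
    simp only [Finset.mem_filter, Finset.mem_powerset, Finset.mem_insert_self, and_true]
    exact Finset.insert_subset ha (hC.trans (Finset.erase_subset _ _))
  · intro C hC D hD h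
    simp only [Finset.mem_powerset] at hC hD
    have h1 : a ∉ C := fun h => Finset.notMem_erase a S (hC h)
    have h2 : a ∉ D := fun h => Finset.notMem_erase a S (hD h)
    rw [← Finset.erase_insert h1, h, Finset.erase_insert h2]
  · intro B hB
    simp only [Finset.mem_filter, Finset.mem_powerset] at hB
    exact ⟨B.erase a, by simpa using Finset.erase_subset_erase a hB.1, Finset.insert_erase hB.2⟩
  · intro C hC
    simp only [Finset.mem_powerset] at hC
    have h1 : a ∉ C := fun h => Finset.notMem_erase a S (hC h)
    have h3 : insert a C ⊆ S := Finset.insert_subset ha (hC.trans (Finset.erase_subset _ _))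
    rw [Finset.card_sdiff_of_subset h3, Finset.card_insert_of_notMem h1, hn]
    congr 2
    omega

theorem blockConv_sub (f u v : ℕ → ℚ) : blockConv f (u - v) = blockConv f u - blockConv f v := by
  funext n
  cases n with
  | zero => simp [blockConv]
  | succ n => simp [blockConv, mul_sub, Finset.sum_sub_distrib]

theorem iterate_blockConv_sub (f u v : ℕ → ℚ) (k : ℕ) :
    (blockConv f)^[k] (u - v) = (blockConv f)^[k] u - (blockConv f)^[k] v := by
  induction k with
  | zero => rfl
  | succ k ih => simp only [Function.iterate_succ_apply', ih, blockConv_sub]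

theorem blockConv_single_zero (f : ℕ → ℚ) (hf : f 0 = 0) : blockConv f (Pi.single 0 1) = f := by
  funext n
  cases n with
  | zero => simp [blockConv, hf]
  | succ n =>
    rw [blockConv, Finset.sum_eq_single n]
    · simp
    · intro j hj hjn
      rw [Finset.mem_range] at hj
      rw [Pi.single_eq_of_ne (by omega)]
      simp
    · simp

/-- Iterating raises the order of vanishing. -/
theorem iterate_blockConv_eq_zero (f u : ℕ → ℚ) (m : ℕ) (hu : ∀ n < m, u n = 0) (k n : ℕ)
    (hn : n < m + k) : (blockConv f)^[k] u n = 0 := by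
  induction k generalizing n with
  | zero => exact hu n hn
  | succ k ih =>
    rw [Function.iterate_succ_apply']
    cases n with
    | zero => rfl
    | succ n =>
      refine Finset.sum_eq_zero fun j _ => ?_
      rw [ih (n - j) (by omega)]
      simp

/-- The alternating decomposition of a set of trees telescopes. -/
theorem sum_iterate_blockConv {d : ℕ} (hd : 1 ≤ d) {f : ℕ → ℚ} (hf0 : f 0 = 0)
    (hf : f = Pi.single 1 1 - (blockConv f)^[d] (Pi.single 1 1)) (n m : ℕ) (hm : n ≤ m) :
    ∑ j ∈ Finset.range (m + 1), (blockConv f)^[d * j + 1] (Pi.single 0 1) n =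
      (Pi.single 1 1 : ℕ → ℚ) n := by
  -- The innermost application produces `f` itself, which `hf` splits into a difference.
  have key : ∀ k, (blockConv f)^[k + 1] (Pi.single 0 1) =
      (blockConv f)^[k] (Pi.single 1 1) - (blockConv f)^[k + d] (Pi.single 1 1) := by
    intro k
    rw [Function.iterate_succ_apply, blockConv_single_zero f hf0, Function.iterate_add_apply,
      ← iterate_blockConv_sub, ← hf]
  have : ∀ j, (blockConv f)^[d * j + 1] (Pi.single 0 1) n =
      (blockConv f)^[d * j] (Pi.single 1 1) n - (blockConv f)^[d * (j + 1)] (Pi.single 1 1) n := by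
    intro j
    rw [key, mul_add, mul_one, Pi.sub_apply]
  rw [Finset.sum_congr rfl fun j _ => this j,
    Finset.sum_range_sub' fun j => (blockConv f)^[d * j] (Pi.single 1 1) n]
  -- The last term of the telescoping sum vanishes in all degrees below `1 + d * (m + 1)`, which
  -- exceeds `n`.
  rw [iterate_blockConv_eq_zero f (Pi.single 1 1) 1
    (fun i hi => Pi.single_eq_of_ne (by omega) _) (d * (m + 1)) n (by nlinarith)]
  simp

/-! ### Exponential generating functions -/

/-- The exponential generating function of a sequence. -/
noncomputable def egf (f : ℕ → ℚ) : ℚ⟦X⟧ := PowerSeries.mk fun n => f n / (n.factorial : ℚ)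

theorem egf_single_zero : egf (Pi.single 0 1) = 1 := by
  ext n
  rw [egf, PowerSeries.coeff_mk, PowerSeries.coeff_one]
  rcases eq_or_ne n 0 with rfl | hn
  · simp
  · rw [Pi.single_eq_of_ne hn, if_neg hn, zero_div]

theorem constantCoeff_egf (f : ℕ → ℚ) : PowerSeries.constantCoeff (egf f) = f 0 := by
  rw [← PowerSeries.coeff_zero_eq_constantCoeff_apply, egf, PowerSeries.coeff_mk]
  simp

/-- Differentiation drops the distinguished element: the shift `f (j + 1)` is the coefficient shift
of the derivative, and the binomial becomes the Cauchy product. -/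
theorem derivative_egf_blockConv (f u : ℕ → ℚ) :
    PowerSeries.derivative ℚ (egf (blockConv f u)) = PowerSeries.derivative ℚ (egf f) * egf u := by
  ext n
  rw [PowerSeries.coeff_derivative, PowerSeries.coeff_mul,
    Finset.Nat.sum_antidiagonal_eq_sum_range_succ
      (fun i j => PowerSeries.coeff i (PowerSeries.derivative ℚ (egf f)) *
        PowerSeries.coeff j (egf u))]
  simp only [egf, PowerSeries.coeff_mk, PowerSeries.coeff_derivative, blockConv]
  rw [Finset.sum_div, Finset.sum_mul]
  refine Finset.sum_congr rfl fun j hj => ?_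
  rw [Finset.mem_range] at hj
  rw [Nat.cast_choose ℚ (by omega : j ≤ n)]
  have h1 : ((n.factorial : ℕ) : ℚ) ≠ 0 := by positivity
  have h2 : ((j.factorial : ℕ) : ℚ) ≠ 0 := by positivity
  have h3 : (((n - j).factorial : ℕ) : ℚ) ≠ 0 := by positivity
  rw [Nat.factorial_succ, Nat.factorial_succ]
  push_cast
  field_simp

/-- Both sides have derivative (k+1) F' F^k in the inductive step and constant term 0. -/
theorem egf_iterate_blockConv (f : ℕ → ℚ) (hf0 : f 0 = 0) (k : ℕ) :
    (k.factorial : ℚ) • egf ((blockConv f)^[k] (Pi.single 0 1)) = egf f ^ k := by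
  induction k with
  | zero => simp [egf_single_zero]
  | succ k ih =>
    apply PowerSeries.derivative.ext
    · rw [Derivation.map_smul, Function.iterate_succ_apply', derivative_egf_blockConv,
        PowerSeries.derivative_pow, Nat.add_sub_cancel, ← ih, Nat.factorial_succ]
      simp only [PowerSeries.smul_eq_C_mul, Nat.cast_mul, map_mul, map_natCast]
      ring
    · rw [map_pow, constantCoeff_egf, hf0, PowerSeries.smul_eq_C_mul, map_mul, constantCoeff_egf,
        Function.iterate_succ_apply']
      simp [blockConv]

/-! ### The compositional inverse -/

theorem stretch_injOn {d : ℕ} (hd : 1 ≤ d) {m n : ℕ} (hm : 1 ≤ m) (hn : 1 ≤ n)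
    (h : stretch d m = stretch d n) : m = n := by
  unfold stretch at h
  have : d * (m - 1) = d * (n - 1) := by omega
  have := Nat.eq_of_mul_eq_mul_left hd this
  omega

theorem coeff_expSeriesAlong {d : ℕ} (hd : 1 ≤ d) (c : ℕ → ℚ) {n : ℕ} (hn : 1 ≤ n) :
    PowerSeries.coeff (d * (n - 1) + 1) (expSeriesAlong d c) =
      c n / ((d * (n - 1) + 1).factorial : ℚ) := by
  rw [expSeriesAlong, PowerSeries.coeff_mk, Finset.sum_eq_single n]
  · simp [stretch]
  · intro m hm hmn
    rw [Finset.mem_Icc] at hm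
    exact if_neg fun h => hmn (stretch_injOn hd hm.1 hn h)
  · intro h
    exfalso
    apply h
    rw [Finset.mem_Icc]
    refine ⟨hn, ?_⟩
    obtain ⟨m, rfl⟩ : ∃ m, n = m + 1 := ⟨n - 1, by omega⟩
    simp only [Nat.add_sub_cancel]
    nlinarith

theorem coeff_expSeriesAlong_of_ne {d : ℕ} (c : ℕ → ℚ) {m : ℕ}
    (hm : ∀ j, m ≠ d * j + 1) : PowerSeries.coeff m (expSeriesAlong d c) = 0 := by
  rw [expSeriesAlong, PowerSeries.coeff_mk]
  exact Finset.sum_eq_zero fun n _ => if_neg fun h => hm (n - 1) h.symm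

theorem constantCoeff_hyperbolicSeries (d : ℕ) :
    PowerSeries.constantCoeff (hyperbolicSeries d) = 0 := by
  rw [← PowerSeries.coeff_zero_eq_constantCoeff_apply]
  exact coeff_expSeriesAlong_of_ne _ fun j => by omega

theorem coeff_one_hyperbolicSeries {d : ℕ} (hd : 1 ≤ d) :
    PowerSeries.coeff 1 (hyperbolicSeries d) = 1 := by
  simpa [hyperbolicSeries] using coeff_expSeriesAlong hd (fun _ => 1) le_rfl

theorem existsUnique_isCompInverse {P : ℚ⟦X⟧} (hP : PowerSeries.constantCoeff P = 0)
    (hP' : IsUnit (PowerSeries.coeff 1 P)) : ∃! g : ℚ⟦X⟧, IsCompInverse P g := by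
  refine ⟨P.substInvOfIsUnit hP', ⟨hP, by simp, ?_, ?_⟩, ?_⟩
  · exact P.subst_substInvOfIsUnit_right hP hP'
  · exact P.subst_substInvOfIsUnit_left hP hP'
  · rintro g ⟨-, hg, h1, -⟩
    have hs := PowerSeries.HasSubst.of_constantCoeff_zero' hg
    calc g = PowerSeries.subst g (PowerSeries.X : ℚ⟦X⟧) := (PowerSeries.subst_X hs).symm
      _ = PowerSeries.subst g (PowerSeries.subst P (P.substInvOfIsUnit hP')) := by
          rw [P.subst_substInvOfIsUnit_left hP hP']
      _ = _ := by
          rw [PowerSeries.subst_comp_subst_apply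
            (PowerSeries.HasSubst.of_constantCoeff_zero' hP) hs, h1]
          exact (PowerSeries.map_algebraMap_eq_subst_X (P.substInvOfIsUnit hP')).symm.trans
            (by simp)

/-- g' = g(P(g')) = g, so one composite suffices to recognise the inverse. -/
theorem eq_of_subst_eq_X {P g g' : ℚ⟦X⟧} (hg : IsCompInverse P g)
    (hg' : PowerSeries.constantCoeff g' = 0) (h : PowerSeries.subst g' P = (PowerSeries.X : ℚ⟦X⟧)) :
    g' = g := by
  have hs := PowerSeries.HasSubst.of_constantCoeff_zero' hg'
  calc g' = PowerSeries.subst g' (PowerSeries.X : ℚ⟦X⟧) := (PowerSeries.subst_X hs).symm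
    _ = PowerSeries.subst g' (PowerSeries.subst P g) := by rw [hg.2.2.2]
    _ = g := by
      rw [PowerSeries.subst_comp_subst_apply
        (PowerSeries.HasSubst.of_constantCoeff_zero' hg.1) hs, h]
      exact (PowerSeries.map_algebraMap_eq_subst_X g).symm.trans (by simp)

theorem subst_egf_hyperbolicSeries {d : ℕ} (hd : 1 ≤ d) {f : ℕ → ℚ} (hf0 : f 0 = 0)
    (hf : f = Pi.single 1 1 - (blockConv f)^[d] (Pi.single 1 1)) :
    PowerSeries.subst (egf f) (hyperbolicSeries d) = (PowerSeries.X : ℚ⟦X⟧) := by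
  have hs : PowerSeries.HasSubst (egf f) :=
    PowerSeries.HasSubst.of_constantCoeff_zero' (by rw [constantCoeff_egf, hf0])
  ext n
  have hinj : Function.Injective fun j => d * j + 1 := fun i j h =>
    Nat.eq_of_mul_eq_mul_left hd (by simpa using h)
  have hterm : ∀ j, PowerSeries.coeff (d * j + 1) (hyperbolicSeries d) •
      PowerSeries.coeff n (egf f ^ (d * j + 1)) =
      (blockConv f)^[d * j + 1] (Pi.single 0 1) n / (n.factorial : ℚ) := by
    intro j
    have h1 := coeff_expSeriesAlong hd (fun _ => 1) (Nat.le_add_left 1 j)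
    rw [Nat.add_sub_cancel] at h1
    rw [hyperbolicSeries, h1, ← egf_iterate_blockConv f hf0, PowerSeries.coeff_smul, smul_eq_mul, smul_eq_mul,
      egf, PowerSeries.coeff_mk]
    have : (((d * j + 1).factorial : ℕ) : ℚ) ≠ 0 := by positivity
    field_simp
  -- Only exponents `d * j + 1` with `j ≤ n` matter, because the term of index `j` vanishes in
  -- degrees below `d * j + 1`.
  rw [PowerSeries.coeff_subst' hs, finsum_eq_sum_of_support_subset (s :=
    (Finset.range (n + 1)).map ⟨fun j => d * j + 1, hinj⟩)]
  · rw [Finset.sum_map]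
    simp only [Function.Embedding.coeFn_mk]
    rw [Finset.sum_congr rfl fun j _ => hterm j, ← Finset.sum_div,
      sum_iterate_blockConv hd hf0 hf n n le_rfl, PowerSeries.coeff_X]
    rcases eq_or_ne n 1 with rfl | hn
    · simp
    · rw [Pi.single_eq_of_ne hn, if_neg hn, zero_div]
  · intro k hk
    rw [Function.mem_support] at hk
    by_cases h : ∃ j, k = d * j + 1
    · obtain ⟨j, rfl⟩ := h
      rw [hterm] at hk
      simp only [Finset.coe_map, Set.mem_image, Function.Embedding.coeFn_mk, Finset.mem_coe,
        Finset.mem_range]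
      refine ⟨j, ?_, rfl⟩
      by_contra hj
      apply hk
      rw [iterate_blockConv_eq_zero f _ 0 (by simp) _ _ (by nlinarith), zero_div]
    · push Not at h
      exact absurd (by rw [hyperbolicSeries, coeff_expSeriesAlong_of_ne _ h, zero_smul]) hk

/-! ### Weighted sums over set partitions -/

namespace Finpartition

variable {α : Type*} [DecidableEq α]

/-- The product of the weights `f #B` over all blocks `B` of a set partition. -/
def blockWeight (f : ℕ → ℚ) {S : Finset α} (σ : Finpartition S) : ℚ := ∏ B ∈ σ.parts, f B.card

theorem sup_erase_parts {S B : Finset α} (σ : Finpartition S) (hB : B ∈ σ.parts) :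
    (σ.parts.erase B).sup id = S \ B := by
  ext x
  simp only [Finset.mem_sup, Finset.mem_erase, id, Finset.mem_sdiff]
  constructor
  · rintro ⟨C, ⟨hCB, hC⟩, hx⟩
    exact ⟨σ.subset hC hx, fun hxB => hCB (σ.eq_of_mem_parts hC hB hx hxB)⟩
  · rintro ⟨hxS, hxB⟩
    obtain ⟨C, hC, hx⟩ := σ.exists_mem hxS
    exact ⟨C, ⟨fun h => hxB (h ▸ hx), hC⟩, hx⟩

/-- Deleting the block of `a` is a bijection onto the partitions of `S \ B`, with inverse `extend`.
-/
theorem sum_blockWeight_part_eq (f : ℕ → ℚ) {S B : Finset α} {a : α} (hB : B ⊆ S) (ha : a ∈ B)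
    (k : ℕ) :
    ∑ σ : Finpartition S with σ.parts.card = k + 1 ∧ σ.part a = B, σ.blockWeight f =
      f B.card * ∑ τ : Finpartition (S \ B) with τ.parts.card = k, τ.blockWeight f := by
  have hne : B ≠ ⊥ := Finset.nonempty_iff_ne_empty.1 ⟨a, ha⟩
  have hdis : Disjoint (S \ B) B := Finset.sdiff_disjoint
  have hsup : (S \ B) ⊔ B = S := Finset.sdiff_union_of_subset hB
  have hnot : ∀ τ : Finpartition (S \ B), B ∉ τ.parts := fun τ h =>
    (Finset.mem_sdiff.1 (τ.subset h ha)).2 ha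
  rw [Finset.mul_sum]
  symm
  refine Finset.sum_bij (fun τ _ => τ.extend hne hdis hsup) ?_ ?_ ?_ ?_
  · intro τ hτ
    simp only [Finset.mem_filter, Finset.mem_univ, true_and] at hτ ⊢
    exact ⟨by rw [card_extend, hτ], part_eq_of_mem _ (Finset.mem_insert_self _ _) ha⟩
  · intro τ _ τ' _ h
    have h' : insert B τ.parts = insert B τ'.parts := congrArg parts h
    ext1
    rw [← Finset.erase_insert (hnot τ), h', Finset.erase_insert (hnot τ')]
  · intro σ hσ
    simp only [Finset.mem_filter, Finset.mem_univ, true_and] at hσ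
    have hBσ : B ∈ σ.parts := by
      rw [← hσ.2, part_mem]
      exact hB ha
    refine ⟨σ.ofSubset (Finset.erase_subset B _) (σ.sup_erase_parts hBσ), ?_, ?_⟩
    · simp only [Finset.mem_filter, Finset.mem_univ, true_and, ofSubset_parts]
      rw [Finset.card_erase_of_mem hBσ, hσ.1, Nat.add_sub_cancel]
    · ext1
      simp only [extend_parts, ofSubset_parts]
      exact Finset.insert_erase hBσ
  · intro τ _
    simp only [blockWeight, extend_parts]
    rw [Finset.prod_insert (hnot τ)]

/-- The exponential formula: set partitions with `k` blocks. -/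
theorem sum_blockWeight_card_eq (f : ℕ → ℚ) (k : ℕ) (S : Finset α) :
    ∑ σ : Finpartition S with σ.parts.card = k, σ.blockWeight f =
      (blockConv f)^[k] (Pi.single 0 1) S.card := by
  induction k generalizing S with
  | zero =>
    rw [Function.iterate_zero, id]
    rcases S.eq_empty_or_nonempty with rfl | hS
    · rw [Finset.filter_true_of_mem]
      · have : Unique (Finpartition (∅ : Finset α)) :=
          inferInstanceAs (Unique (Finpartition (⊥ : Finset α)))
        rw [Fintype.sum_unique, blockWeight, Finset.card_empty, Pi.single_eq_same,
          parts_eq_empty_iff.2 rfl, Finset.prod_empty]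
      · intro σ _
        rw [Finset.card_eq_zero, parts_eq_empty_iff]
        rfl
    · rw [Pi.single_eq_of_ne (Finset.card_pos.2 hS).ne', Finset.filter_false_of_mem,
        Finset.sum_empty]
      intro σ _ h
      rw [Finset.card_eq_zero, parts_eq_empty_iff] at h
      exact hS.ne_empty h
  | succ k ih =>
    rw [Function.iterate_succ_apply']
    rcases S.eq_empty_or_nonempty with rfl | ⟨a, ha⟩
    · rw [Finset.filter_false_of_mem, Finset.sum_empty, Finset.card_empty, blockConv]
      intro σ _ h
      have : σ.parts = ∅ := σ.parts_eq_empty_iff.2 rfl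
      rw [this] at h
      simp at h
    · rw [← sum_blocks_eq_blockConv f _ ha, ← Finset.sum_fiberwise_of_maps_to
        (t := S.powerset.filter (a ∈ ·)) (g := fun σ : Finpartition S => σ.part a)]
      · refine Finset.sum_congr rfl fun B hB => ?_
        rw [Finset.mem_filter, Finset.mem_powerset] at hB
        rw [Finset.filter_filter, sum_blockWeight_part_eq f hB.1 hB.2, ih]
      · intro σ _
        rw [Finset.mem_filter, Finset.mem_powerset]
        exact ⟨σ.part_subset a, σ.mem_part_self.2 ha⟩

theorem sup_filter_subset {x y : Finpartition S} (h : x ≤ y) {B : Finset α} (hB : B ∈ y.parts) :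
    (x.parts.filter (· ⊆ B)).sup id = B := by
  ext a
  simp only [Finset.mem_sup, Finset.mem_filter, id]
  constructor
  · rintro ⟨C, ⟨_, hCB⟩, ha⟩
    exact hCB ha
  · intro ha
    obtain ⟨C, hC, haC⟩ := x.exists_mem (y.subset hB ha)
    obtain ⟨B', hB', hCB'⟩ := h hC
    obtain rfl : B' = B := y.eq_of_mem_parts hB' hB (hCB' haC) ha
    exact ⟨C, ⟨hC, hCB'⟩, haC⟩

/-- Refinements of `π` are families of set partitions of its blocks. -/
theorem sum_blockWeight_le (f : ℕ → ℚ) {S : Finset α} (π : Finpartition S)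
    [DecidablePred fun σ : Finpartition S => σ ≤ π] :
    ∑ σ : Finpartition S with σ ≤ π, σ.blockWeight f =
      ∏ B ∈ π.parts, ∑ τ : Finpartition B, τ.blockWeight f := by
  rw [Finset.prod_sum]
  symm
  have hmem : ∀ (p : ∀ B ∈ π.parts, Finpartition B) (B) (hB : B ∈ π.parts) (C : Finset α),
      C ∈ (p B hB).parts ↔ C ∈ (π.bind p).parts ∧ C ⊆ B := by
    intro p B hB C
    rw [mem_bind]
    constructor
    · exact fun h => ⟨⟨B, hB, h⟩, subset _ h⟩
    · rintro ⟨⟨B', hB', h⟩, hCB⟩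
      obtain ⟨x, hx⟩ := nonempty_of_mem_parts _ h
      obtain rfl : B' = B := π.eq_of_mem_parts hB' hB (subset _ h hx) (hCB hx)
      exact h
  refine Finset.sum_bij (fun p _ => π.bind p) ?_ ?_ ?_ ?_
  · intro p _
    simp only [Finset.mem_filter, Finset.mem_univ, true_and]
    intro C hC
    obtain ⟨B, hB, h⟩ := mem_bind.1 hC
    exact ⟨B, hB, subset _ h⟩
  · intro p _ q _ h
    funext B hB
    ext C
    rw [hmem, hmem, h]
  · intro σ hσ
    simp only [Finset.mem_filter, Finset.mem_univ, true_and] at hσ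
    refine ⟨fun B hB => σ.ofSubset (Finset.filter_subset _ _) (sup_filter_subset hσ hB),
      by simp, ?_⟩
    ext C
    rw [mem_bind]
    constructor
    · rintro ⟨B, hB, h⟩
      exact (Finset.mem_filter.1 h).1
    · intro hC
      obtain ⟨B, hB, h⟩ := hσ hC
      exact ⟨B, hB, Finset.mem_filter.2 ⟨hC, h⟩⟩
  · intro p _
    rw [blockWeight, bind_parts, Finset.prod_biUnion]
    · rfl
    · intro B _ B' _ hBB'
      rw [Function.onFun, Finset.disjoint_left]
      intro C hC hC'
      obtain ⟨x, hx⟩ := nonempty_of_mem_parts _ hC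
      exact hBB' (Subtype.ext (π.eq_of_mem_parts B.2 B'.2 (subset _ hC hx) (subset _ hC' hx)))

theorem card_parts_modEq {d : ℕ} {S : Finset α} (σ : Finpartition S)
    (h : ∀ B ∈ σ.parts, B.card ≡ 1 [MOD d]) : σ.parts.card ≡ S.card [MOD d] := by
  rw [← σ.sum_card_parts, Finset.card_eq_sum_ones, Nat.ModEq, Finset.sum_nat_mod,
    Finset.sum_nat_mod σ.parts d Finset.card]
  congr 1
  exact Finset.sum_congr rfl fun B hB => (h B hB).symm

theorem blockWeight_eq_zero {d : ℕ} {f : ℕ → ℚ} (hs : ∀ n, f n ≠ 0 → n ≡ 1 [MOD d])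
    {S : Finset α} (σ : Finpartition S) (h : ¬ ∀ B ∈ σ.parts, B.card ≡ 1 [MOD d]) :
    σ.blockWeight f = 0 := by
  push Not at h
  obtain ⟨B, hB, h⟩ := h
  exact Finset.prod_eq_zero hB (by_contra fun h' => h (hs _ h'))

/-- A partition of nonzero weight has a number of blocks congruent to #S, hence to 1, mod d.
Grouping by that number `d * j + 1` gives exactly the telescoping sum. -/
theorem sum_blockWeight {d : ℕ} (hd : 1 ≤ d) {f : ℕ → ℚ} (hs : ∀ n, f n ≠ 0 → n ≡ 1 [MOD d])
    (hf0 : f 0 = 0) (hf : f = Pi.single 1 1 - (blockConv f)^[d] (Pi.single 1 1))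
    {S : Finset α} (hS : S.card ≡ 1 [MOD d]) (hS0 : S.Nonempty) :
    ∑ σ : Finpartition S, σ.blockWeight f = if S.card = 1 then 1 else 0 := by
  have hzero : ∀ σ : Finpartition S, σ.blockWeight f ≠ 0 →
      ∃ j ≤ S.card, σ.parts.card = d * j + 1 := by
    intro σ hσ
    have h1 : 1 ≤ σ.parts.card := Finset.card_pos.2 (σ.parts_nonempty hS0.ne_empty)
    have h2 := (σ.card_parts_modEq
      (by_contra fun h => hσ (σ.blockWeight_eq_zero hs h))).trans hS
    obtain ⟨j, hj⟩ := (Nat.modEq_iff_dvd' h1).1 h2.symm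
    have := σ.card_parts_le_card
    exact ⟨j, (Nat.le_mul_of_pos_left j hd).trans (by omega), by omega⟩
  have h := sum_iterate_blockConv hd hf0 hf S.card S.card le_rfl
  simp only [← sum_blockWeight_card_eq] at h
  rw [Pi.single_apply] at h
  rw [← h]
  simp only [Finset.sum_filter]
  rw [Finset.sum_comm]
  refine Finset.sum_congr rfl fun σ _ => ?_
  by_cases hσ : σ.blockWeight f = 0
  · simp [hσ]
  · obtain ⟨j, hj, hc⟩ := hzero σ hσ
    rw [Finset.sum_eq_single j]
    · rw [if_pos hc]
    · intro i _ hij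
      refine if_neg fun h => hij ?_
      rw [hc] at h
      exact (Nat.eq_of_mul_eq_mul_left hd (by omega)).symm
    · intro h
      exact absurd (Finset.mem_range.2 (by omega)) h

theorem eq_bot_iff_card {S : Finset α} (π : Finpartition S) :
    π = ⊥ ↔ ∀ B ∈ π.parts, B.card = 1 := by
  constructor
  · rintro rfl B hB
    obtain ⟨a, -, rfl⟩ := mem_bot_iff.1 hB
    exact Finset.card_singleton a
  · intro h
    refine le_bot_iff.1 fun B hB => ⟨B, ?_, le_rfl⟩
    obtain ⟨a, rfl⟩ := Finset.card_eq_one.1 (h B hB)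
    exact mem_bot_iff.2 ⟨a, π.subset hB (Finset.mem_singleton_self a), rfl⟩

end Finpartition

/-! ### The Möbius function -/

/-- The sums over the intervals from `⊥` determine a function by well-founded induction. -/
theorem mu_bot_eq_of_sum {P : Type*} [PartialOrder P] [OrderBot P] [Finite P]
    [LocallyFiniteOrder P] [DecidableEq P] (φ : P → ℚ)
    (h : ∀ x, ∑ y ∈ Finset.Icc ⊥ x, φ y = if ⊥ = x then 1 else 0) (x : P) :
    ((IncidenceAlgebra.mu ℤ (⊥ : P) x : ℤ) : ℚ) = φ x := by
  induction x using WellFoundedLT.induction with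
  | _ x ih =>
    have h1 := h x
    have h2 := congrArg (Int.cast : ℤ → ℚ) (IncidenceAlgebra.sum_Icc_mu_right (𝕜 := ℤ) ⊥ x)
    push_cast at h2
    rw [← h1, ← Finset.Ico_insert_right bot_le, Finset.sum_insert Finset.right_notMem_Ico,
      Finset.sum_insert Finset.right_notMem_Ico,
      Finset.sum_congr rfl fun y hy => ih y (Finset.mem_Ico.1 hy).2] at h2
    exact add_right_cancel h2

theorem OneModPartition.mu_bot_eq {d N : ℕ} (hd : 1 ≤ d) [LocallyFiniteOrder (OneModPartition d N)]
    [DecidableEq (OneModPartition d N)] {f : ℕ → ℚ} (hs : ∀ n, f n ≠ 0 → n ≡ 1 [MOD d])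
    (hf0 : f 0 = 0) (hf : f = Pi.single 1 1 - (blockConv f)^[d] (Pi.single 1 1))
    (x : OneModPartition d N) :
    ((IncidenceAlgebra.mu ℤ (⊥ : OneModPartition d N) x : ℤ) : ℚ) = x.1.blockWeight f := by
  classical
  refine mu_bot_eq_of_sum (fun x : OneModPartition d N => x.1.blockWeight f) (fun x => ?_) x
  have h := x.1.sum_blockWeight_le f
  rw [Finset.prod_congr rfl fun B hB => Finpartition.sum_blockWeight hd hs hf0 hf (x.2 B hB)
    (x.1.nonempty_of_mem_parts hB), Finset.prod_ite_zero, Finset.prod_const_one] at h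
  have hbot : (⊥ = x) ↔ ∀ B ∈ x.1.parts, B.card = 1 := by
    rw [← Finpartition.eq_bot_iff_card, eq_comm, Subtype.ext_iff]
    rfl
  rw [if_congr hbot rfl rfl, ← h]
  -- The refinements of `x` outside the subposet have weight zero, so the sum over all refinements
  -- equals the sum over the interval.
  refine Finset.sum_bij_ne_zero (fun y _ _ => y.1) ?_ ?_ ?_ ?_
  · intro y hy _
    simpa using (Finset.mem_Icc.1 hy).2
  · intro y _ _ z _ _ hyz
    exact Subtype.ext hyz
  · intro σ hσ hne
    have h1 : ∀ B ∈ σ.parts, B.card ≡ 1 [MOD d] :=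
      by_contra fun h => hne (σ.blockWeight_eq_zero hs h)
    exact ⟨⟨σ, h1⟩, Finset.mem_Icc.2 ⟨bot_le, (Finset.mem_filter.1 hσ).2⟩, hne, rfl⟩
  · intro y _ _
    rfl

/-! ### Trees all of whose left-most children are leaves -/

theorem Multiset.sup_mem_of_ne_zero {s : Multiset ℕ} (hs : s ≠ 0) : s.sup ∈ s := by
  induction s using Multiset.induction_on with
  | empty => exact absurd rfl hs
  | cons a s ih =>
    rw [Multiset.sup_cons]
    rcases eq_or_ne s 0 with rfl | h
    · simp
    · rcases le_total a s.sup with h' | h'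
      · rw [sup_eq_right.2 h']
        exact Multiset.mem_cons_of_mem (ih h)
      · rw [sup_eq_left.2 h']
        exact Multiset.mem_cons_self a s

namespace PlaneTree

/-- Every non-leaf vertex has degree `d + 1`, and its left-most child is a leaf. -/
def LeftLeafy (d : ℕ) : PlaneTree → Prop
  | leaf _ => True
  | node k c => k = d + 1 ∧ (∀ i : Fin k, i.val = 0 → ∃ a, c i = leaf a) ∧ ∀ i, (c i).LeftLeafy d

theorem LeftLeafy.card_labels {d : ℕ} {t : PlaneTree} (h : t.LeftLeafy d) :
    ∃ i, t.labels.card = d * i + 1 := by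
  induction t with
  | leaf a => exact ⟨0, rfl⟩
  | node k c ih =>
    obtain ⟨rfl, -, h⟩ := h
    choose i hi using fun j => ih j (h j)
    -- The witness counts internal vertices: those of the child subtrees, plus the root.
    refine ⟨∑ j, i j + 1, ?_⟩
    rw [labels, Multiset.card_sum, Finset.sum_congr rfl fun j _ => hi j, Finset.sum_add_distrib,
      ← Finset.mul_sum]
    simp
    ring

theorem LeftLeafy.labels_ne_zero {d : ℕ} {t : PlaneTree} (h : t.LeftLeafy d) : t.labels ≠ 0 := by
  obtain ⟨i, hi⟩ := h.card_labels
  rintro h0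
  rw [h0] at hi
  simp at hi

theorem LeftLeafy.maxLabel_mem {d : ℕ} {t : PlaneTree} (h : t.LeftLeafy d) :
    t.maxLabel ∈ t.labels :=
  Multiset.sup_mem_of_ne_zero h.labels_ne_zero

/-- Increasingly ordered left-leafy trees with label set `S`. -/
def treesOn (d : ℕ) (S : Finset ℕ) : Set PlaneTree :=
  {t | t.LeftLeafy d ∧ t.IncreasinglyOrdered ∧ t.labels = S.val}

/-- Increasingly ordered forests of `k + 1` such trees on `S`, the first of which is a leaf. -/
def forestsOn (d k : ℕ) (S : Finset ℕ) : Set (Fin (k + 1) → PlaneTree) :=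
  {c | (∃ a, c 0 = leaf a) ∧ (∀ i, (c i).LeftLeafy d ∧ (c i).IncreasinglyOrdered) ∧
    (StrictMono fun i => (c i).maxLabel) ∧ ∑ i, (c i).labels = S.val}

theorem forestsOn_empty (d k : ℕ) : IsEmpty (forestsOn d k ∅) := by
  refine ⟨fun ⟨c, ⟨a, ha⟩, _, _, h⟩ => ?_⟩
  have : a ∈ ∑ i, (c i).labels := Multiset.mem_sum.2 ⟨0, Finset.mem_univ _, by simp [ha, labels]⟩
  rw [h] at this
  simp at this

/-- A tree is a leaf or is obtained by joining a forest to a new root. -/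
def joinForest (d : ℕ) (S : Finset ℕ) : forestsOn d 0 S ⊕ forestsOn d d S → treesOn d S
  | .inl c => ⟨c.1 0, (c.2.2.1 0).1, (c.2.2.1 0).2, by
      have := c.2.2.2.2
      rwa [Fin.sum_univ_one] at this⟩
  | .inr c => ⟨node (d + 1) c.1,
      ⟨rfl, fun i hi => by
        obtain rfl : i = 0 := Fin.ext hi
        exact c.2.1, fun i => (c.2.2.1 i).1⟩,
      ⟨c.2.2.2.1, fun i => (c.2.2.1 i).2⟩, c.2.2.2.2⟩

theorem joinForest_bijective (d : ℕ) (S : Finset ℕ) : Function.Bijective (joinForest d S) := by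
  constructor
  · rintro (⟨c, ⟨a, ha⟩, hc⟩ | ⟨c, hc⟩) (⟨c', ⟨a', ha'⟩, hc'⟩ | ⟨c', hc'⟩) h
    · have h : c 0 = c' 0 := congrArg Subtype.val h
      refine congrArg Sum.inl (Subtype.ext (funext fun i => ?_))
      rw [Fin.fin_one_eq_zero i]
      exact h
    · have h : c 0 = node (d + 1) c' := congrArg Subtype.val h
      rw [ha] at h
      cases h
    · have h : node (d + 1) c = c' 0 := congrArg Subtype.val h
      rw [ha'] at h
      cases h
    · have h : node (d + 1) c = node (d + 1) c' := congrArg Subtype.val h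
      cases h
      rfl
  · rintro ⟨t, h1, h2, h3⟩
    cases t with
    | leaf a =>
      exact ⟨.inl ⟨fun _ => leaf a, ⟨a, rfl⟩, fun _ => ⟨h1, h2⟩, Subsingleton.strictMono (α := Fin 1) _, by
        rw [Fin.sum_univ_one]; exact h3⟩, rfl⟩
    | node k c =>
      obtain ⟨rfl, h4, h5⟩ := h1
      exact ⟨.inr ⟨c, h4 0 rfl, fun i => ⟨h5 i, h2.2 i⟩, h2.1, h3⟩, rfl⟩

/-- A forest is obtained by appending the tree that contains the largest label. -/
theorem snoc_mem_forestsOn {d k : ℕ} {S B : Finset ℕ} (hB : B ⊆ S) (hmax : S.sup id ∈ B)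
    {t : PlaneTree} (ht : t ∈ treesOn d B) {c : Fin (k + 1) → PlaneTree}
    (hc : c ∈ forestsOn d k (S \ B)) :
    (Fin.snoc c t : Fin (k + 1 + 1) → PlaneTree) ∈ forestsOn d (k + 1) S := by
  obtain ⟨ht1, ht2, ht3⟩ := ht
  obtain ⟨⟨a, ha⟩, hc2, hc3, hc4⟩ := hc
  refine ⟨⟨a, ?_⟩, ?_, ?_, ?_⟩
  · rw [← Fin.castSucc_zero, Fin.snoc_castSucc (α := fun _ => PlaneTree), ha]
  · intro i
    refine Fin.lastCases ?_ (fun i => ?_) i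
    · rw [Fin.snoc_last]
      exact ⟨ht1, ht2⟩
    · rw [Fin.snoc_castSucc (α := fun _ => PlaneTree)]
      exact hc2 i
  · intro i j
    refine Fin.lastCases ?_ (fun j => ?_) j
    · refine Fin.lastCases (fun h => absurd h (lt_irrefl _)) (fun i _ => ?_) i
      simp only [Fin.snoc_last, Fin.snoc_castSucc (α := fun _ => PlaneTree)]
      have h1 : (c i).maxLabel ∈ S \ B := by
        rw [← Finset.mem_val, ← hc4]
        exact Multiset.mem_sum.2 ⟨i, Finset.mem_univ _, (hc2 i).1.maxLabel_mem⟩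
      rw [Finset.mem_sdiff] at h1
      have h2 : (c i).maxLabel ≤ S.sup id := Finset.le_sup (f := id) h1.1
      have h3 : S.sup id ≤ t.maxLabel := Multiset.le_sup (by rw [ht3]; exact hmax)
      have h4 : (c i).maxLabel ≠ S.sup id := fun h => h1.2 (h ▸ hmax)
      omega
    · refine Fin.lastCases (fun h => ?_) (fun i h => ?_) i
      · exact absurd h (not_lt.2 (Fin.le_last _))
      · simp only [Fin.snoc_castSucc (α := fun _ => PlaneTree)]
        exact hc3 (Fin.castSucc_lt_castSucc_iff.1 h)
  · rw [Fin.sum_univ_castSucc]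
    simp only [Fin.snoc_last, Fin.snoc_castSucc (α := fun _ => PlaneTree)]
    rw [hc4, ht3, ← Finset.disjUnion_val _ _ Finset.sdiff_disjoint, Finset.disjUnion_eq_union,
      Finset.sdiff_union_of_subset hB]

/-- As `maxLabel` increases along the forest, the last tree holds the largest label; `B` is its
label set. -/
theorem exists_snoc_of_mem_forestsOn {d k : ℕ} {S : Finset ℕ} {c : Fin (k + 1 + 1) → PlaneTree}
    (hc : c ∈ forestsOn d (k + 1) S) :
    ∃ B ⊆ S, S.sup id ∈ B ∧ c (Fin.last (k + 1)) ∈ treesOn d B ∧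
      Fin.init c ∈ forestsOn d k (S \ B) := by
  obtain ⟨⟨a, ha⟩, hc2, hc3, hc4⟩ := hc
  have hsum := hc4
  rw [Fin.sum_univ_castSucc] at hsum
  have hle : (c (Fin.last (k + 1))).labels ≤ S.val := hsum ▸ Multiset.le_add_left _ _
  have hnd : (c (Fin.last (k + 1))).labels.Nodup := Multiset.nodup_of_le hle S.nodup
  have hBS : (⟨_, hnd⟩ : Finset ℕ) ⊆ S := Finset.val_le_iff.1 hle
  refine ⟨⟨_, hnd⟩, hBS, ?_, ⟨(hc2 _).1, (hc2 _).2, rfl⟩, ⟨a, ha⟩,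
    fun i => hc2 i.castSucc, fun i j h => hc3 (Fin.castSucc_lt_castSucc_iff.2 h), ?_⟩
  · have hmem := (hc2 (Fin.last (k + 1))).1.maxLabel_mem
    have : S.sup id = (c (Fin.last (k + 1))).maxLabel := by
      refine le_antisymm (Finset.sup_le fun x hx => ?_) ?_
      · rw [← Finset.mem_val, ← hc4, Multiset.mem_sum] at hx
        obtain ⟨i, -, hx⟩ := hx
        exact (Multiset.le_sup hx).trans (hc3.monotone (Fin.le_last i))
      · exact Finset.le_sup (f := id) (hBS hmem)
    rw [this]
    exact hmem
  · rw [Finset.sdiff_val]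
    exact eq_tsub_of_add_eq hsum

/-- Append a tree to a forest. -/
def appendTree (d k : ℕ) (S : Finset ℕ)
    (x : Σ B : {B // B ∈ S.powerset.filter (S.sup id ∈ ·)},
      treesOn d B.1 × forestsOn d k (S \ B.1)) : forestsOn d (k + 1) S :=
  ⟨Fin.snoc x.2.2.1 x.2.1.1, snoc_mem_forestsOn
    (Finset.mem_powerset.1 (Finset.mem_filter.1 x.1.2).1) (Finset.mem_filter.1 x.1.2).2
    x.2.1.2 x.2.2.2⟩

theorem appendTree_bijective (d k : ℕ) (S : Finset ℕ) : Function.Bijective (appendTree d k S) := by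
  constructor
  · rintro ⟨⟨B, hB⟩, ⟨t, ht⟩, ⟨c, hc⟩⟩ ⟨⟨B', hB'⟩, ⟨t', ht'⟩, ⟨c', hc'⟩⟩ h
    have h : (Fin.snoc c t : Fin (k + 1 + 1) → PlaneTree) = Fin.snoc c' t' :=
      congrArg Subtype.val h
    obtain ⟨rfl, rfl⟩ := Fin.snoc_inj.1 h
    obtain rfl : B = B' := Finset.val_injective (ht.2.2.symm.trans ht'.2.2)
    rfl
  · rintro ⟨c, hc⟩
    obtain ⟨B, hB, hmax, ht, hc'⟩ := exists_snoc_of_mem_forestsOn hc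
    exact ⟨⟨⟨B, Finset.mem_filter.2 ⟨Finset.mem_powerset.2 hB, hmax⟩⟩, ⟨_, ht⟩, ⟨_, hc'⟩⟩,
      Subtype.ext (Fin.snoc_init_self c)⟩

theorem card_forestsOn_zero (d : ℕ) (S : Finset ℕ) :
    Finite (forestsOn d 0 S) ∧
      (Nat.card (forestsOn d 0 S) : ℚ) = (Pi.single 1 1 : ℕ → ℚ) S.card := by
  by_cases hS : ∃ a, S = {a}
  · obtain ⟨a, rfl⟩ := hS
    have : forestsOn d 0 {a} = {fun _ => leaf a} := by
      ext c
      rw [Set.mem_singleton_iff]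
      constructor
      · rintro ⟨⟨b, hb⟩, -, -, h⟩
        rw [Fin.sum_univ_one, hb] at h
        obtain rfl : b = a := Multiset.singleton_inj.1 h
        funext i
        rw [Fin.fin_one_eq_zero i, ← hb]
      · rintro rfl
        exact ⟨⟨a, rfl⟩, fun _ => ⟨trivial, trivial⟩, Subsingleton.strictMono (α := Fin 1) _, by
          rw [Fin.sum_univ_one]; rfl⟩
    rw [this]
    exact ⟨inferInstance, by simp⟩
  · have : IsEmpty (forestsOn d 0 S) := by
      refine ⟨fun ⟨c, ⟨a, ha⟩, _, _, h⟩ => hS ⟨a, ?_⟩⟩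
      rw [Fin.sum_univ_one, ha] at h
      exact Finset.val_injective h.symm
    refine ⟨inferInstance, ?_⟩
    rw [Pi.single_eq_of_ne fun h => hS (Finset.card_eq_one.1 h)]
    simp

/-- Each appended tree is one `blockConv`, with the largest label as distinguished element. Counts
of trees with fewer than `n` labels suffice, because the forest to the left always keeps its first
leaf. -/
theorem card_forestsOn {d n : ℕ} {t : ℕ → ℚ}
    (ht : ∀ B : Finset ℕ, B.card < n →
      Finite (treesOn d B) ∧ (Nat.card (treesOn d B) : ℚ) = t B.card)
    (k : ℕ) (S : Finset ℕ) (hS : S.card ≤ n) :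
    Finite (forestsOn d k S) ∧
      (Nat.card (forestsOn d k S) : ℚ) = (blockConv t)^[k] (Pi.single 1 1) S.card := by
  induction k generalizing S with
  | zero => exact card_forestsOn_zero d S
  | succ k ih =>
    have hblock : ∀ B : {B // B ∈ S.powerset.filter (S.sup id ∈ ·)},
        Finite (treesOn d B.1 × forestsOn d k (S \ B.1)) ∧
        (Nat.card (treesOn d B.1 × forestsOn d k (S \ B.1)) : ℚ) =
          t B.1.card * (blockConv t)^[k] (Pi.single 1 1) (S \ B.1).card := by
      rintro ⟨B, hB⟩
      rw [Finset.mem_filter, Finset.mem_powerset] at hB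
      dsimp only
      obtain ⟨hfin, hcard⟩ := ih (S \ B) ((Finset.card_le_card Finset.sdiff_subset).trans hS)
      -- For `B = S` no forest is left on the complement, so both sides vanish and `ht` is not
      -- needed at size `n`.
      rcases eq_or_ne B S with rfl | hne
      · have := forestsOn_empty d k
        rw [Finset.sdiff_self] at hcard ⊢
        rw [← hcard]
        exact ⟨inferInstance, by simp⟩
      · obtain ⟨hfin', hcard'⟩ := ht B
          ((Finset.card_lt_card (hB.1.ssubset_of_ne hne)).trans_le hS)
        exact ⟨inferInstance, by rw [Nat.card_prod, Nat.cast_mul, hcard, hcard']⟩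
    have hfin := fun B => (hblock B).1
    let e := Equiv.ofBijective _ (appendTree_bijective d k S)
    refine ⟨Finite.of_equiv _ e, ?_⟩
    rw [← Nat.card_congr e, Nat.card_sigma, Nat.cast_sum,
      Finset.sum_congr rfl fun B _ => (hblock B).2, Function.iterate_succ_apply']
    rw [Finset.sum_coe_sort (S.powerset.filter (S.sup id ∈ ·)) fun B =>
      t B.card * (blockConv t)^[k] (Pi.single 1 1) (S \ B).card]
    rcases S.eq_empty_or_nonempty with rfl | hne
    · rw [Finset.filter_false_of_mem]
      · rfl
      · intro B hB h
        exact absurd (Finset.mem_powerset.1 hB h) (Finset.notMem_empty _)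
    · refine sum_blocks_eq_blockConv _ _ ?_
      obtain ⟨x, hx, h⟩ := Finset.exists_mem_eq_sup S hne id
      rw [h]
      exact hx

/-- The number of increasingly ordered left-leafy trees with `n` leaves. -/
noncomputable def treeCount (d n : ℕ) : ℚ := Nat.card (treesOn d (Finset.Icc 1 n))

theorem card_treesOn_aux {d n : ℕ}
    (ht : ∀ B : Finset ℕ, B.card < n →
      Finite (treesOn d B) ∧ (Nat.card (treesOn d B) : ℚ) = treeCount d B.card)
    (S : Finset ℕ) (hS : S.card = n) :
    Finite (treesOn d S) ∧ (Nat.card (treesOn d S) : ℚ) =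
      (Pi.single 1 1 : ℕ → ℚ) n + (blockConv (treeCount d))^[d] (Pi.single 1 1) n := by
  let e := Equiv.ofBijective _ (joinForest_bijective d S)
  obtain ⟨h1, h2⟩ := card_forestsOn_zero d S
  obtain ⟨h3, h4⟩ := card_forestsOn ht d S hS.le
  refine ⟨Finite.of_equiv _ e, ?_⟩
  rw [← Nat.card_congr e, Nat.card_sum, Nat.cast_add, h2, h4, hS]

/-- By strong induction on the size, the same recursion evaluates the count on `S` and on the
interval that defines `treeCount`. -/
theorem card_treesOn (d : ℕ) (S : Finset ℕ) :
    Finite (treesOn d S) ∧ (Nat.card (treesOn d S) : ℚ) = treeCount d S.card := by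
  obtain ⟨n, hn⟩ : ∃ n, S.card = n := ⟨_, rfl⟩
  induction n using Nat.strong_induction_on generalizing S with
  | _ n ih =>
    have ht := fun B (hB : B.card < n) => ih _ hB B rfl
    obtain ⟨h1, h2⟩ := card_treesOn_aux ht S hn
    refine ⟨h1, ?_⟩
    rw [h2, hn, treeCount, (card_treesOn_aux ht (Finset.Icc 1 n) (by simp)).2]

theorem treeCount_eq (d : ℕ) :
    treeCount d = Pi.single 1 1 + (blockConv (treeCount d))^[d] (Pi.single 1 1) := by
  funext n
  exact (card_treesOn_aux (fun B _ => card_treesOn d B) (Finset.Icc 1 n) (by simp)).2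

theorem eq_of_treeCount_ne_zero {d n : ℕ} (h : treeCount d n ≠ 0) : ∃ i, n = d * i + 1 := by
  rw [treeCount, Nat.cast_ne_zero, Nat.card_ne_zero] at h
  obtain ⟨⟨t, ht, -, h⟩⟩ := h.1
  obtain ⟨i, hi⟩ := ht.card_labels
  rw [h] at hi
  exact ⟨i, by simpa using hi⟩

end PlaneTree

/-! ### Signs -/

/-- Passing to signed counts, where a tree with `d * i + 1` leaves has sign `(-1) ^ i`. -/
theorem iterate_blockConv_signed {d : ℕ} (hd : 1 ≤ d) {t f : ℕ → ℚ}
    (hf : ∀ i, f (d * i + 1) = (-1) ^ i * t (d * i + 1))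
    (hs : ∀ n, (∀ i, n ≠ d * i + 1) → f n = 0 ∧ t n = 0) (k : ℕ) :
    (∀ i, (blockConv f)^[k] (Pi.single 1 1) (d * i + k + 1) =
      (-1) ^ i * (blockConv t)^[k] (Pi.single 1 1) (d * i + k + 1)) ∧
    ∀ n, (∀ i, n ≠ d * i + k + 1) →
      (blockConv f)^[k] (Pi.single 1 1) n = 0 ∧ (blockConv t)^[k] (Pi.single 1 1) n = 0 := by
  induction k with
  | zero =>
    refine ⟨fun i => ?_, fun n hn => ?_⟩
    · rcases Nat.eq_zero_or_pos i with rfl | h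
      · simp
      · have : 0 < d * i := Nat.mul_pos hd h
        simp only [Function.iterate_zero, id]
        rw [Pi.single_eq_of_ne (by omega), mul_zero]
    · have : n ≠ 1 := by simpa using hn 0
      simp only [Function.iterate_zero, id]
      rw [Pi.single_eq_of_ne this]
      exact ⟨rfl, rfl⟩
  | succ k ih =>
    simp only [Function.iterate_succ_apply']
    obtain ⟨ih1, ih2⟩ := ih
    have hterm : ∀ a b, (f a * (blockConv f)^[k] (Pi.single 1 1) b = 0 ∧
        t a * (blockConv t)^[k] (Pi.single 1 1) b = 0) ∨
        ∃ i j, a = d * i + 1 ∧ b = d * j + k + 1 := by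
      intro a b
      by_cases ha : ∃ i, a = d * i + 1
      · by_cases hb : ∃ j, b = d * j + k + 1
        · obtain ⟨i, hi⟩ := ha
          obtain ⟨j, hj⟩ := hb
          exact Or.inr ⟨i, j, hi, hj⟩
        · obtain ⟨h1, h2⟩ := ih2 b (not_exists.1 hb)
          exact Or.inl ⟨by rw [h1, mul_zero], by rw [h2, mul_zero]⟩
      · obtain ⟨h1, h2⟩ := hs a (not_exists.1 ha)
        exact Or.inl ⟨by rw [h1, zero_mul], by rw [h2, zero_mul]⟩
    refine ⟨fun i => ?_, fun n hn => ?_⟩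
    · rw [blockConv, blockConv, Finset.mul_sum]
      refine Finset.sum_congr rfl fun j hj => ?_
      rw [Finset.mem_range] at hj
      rcases hterm (j + 1) (d * i + (k + 1) - j) with ⟨h1, h2⟩ | ⟨a, b, ha, hb⟩
      · rw [h1, h2]
        simp
      · have h3 : i = a + b := Nat.eq_of_mul_eq_mul_left hd (by rw [mul_add]; omega)
        rw [ha, hb, hf, ih1, h3, pow_add]
        ring
    · cases n with
      | zero => exact ⟨rfl, rfl⟩
      | succ n =>
        have h : ∀ j ∈ Finset.range (n + 1),
            f (j + 1) * (blockConv f)^[k] (Pi.single 1 1) (n - j) = 0 ∧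
            t (j + 1) * (blockConv t)^[k] (Pi.single 1 1) (n - j) = 0 := by
          intro j hj
          rw [Finset.mem_range] at hj
          rcases hterm (j + 1) (n - j) with h | ⟨a, b, ha, hb⟩
          · exact h
          · exact absurd (by rw [mul_add]; omega) (hn (a + b))
        exact ⟨Finset.sum_eq_zero fun j hj => by rw [(h j hj).1, mul_zero],
          Finset.sum_eq_zero fun j hj => by rw [(h j hj).2, mul_zero]⟩

namespace PlaneTree

/-- The number of increasingly ordered left-leafy trees with `n` leaves, with the sign
`(-1) ^ i` for `i` internal vertices. -/
noncomputable def signedTreeCount (d n : ℕ) : ℚ := (-1) ^ ((n - 1) / d) * treeCount d n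

theorem signedTreeCount_mul_add_one {d : ℕ} (hd : 1 ≤ d) (i : ℕ) :
    signedTreeCount d (d * i + 1) = (-1) ^ i * treeCount d (d * i + 1) := by
  rw [signedTreeCount, Nat.add_sub_cancel, Nat.mul_div_cancel_left _ hd]

theorem signedTreeCount_eq_zero {d n : ℕ} (h : ∀ i, n ≠ d * i + 1) :
    signedTreeCount d n = 0 ∧ treeCount d n = 0 := by
  have : treeCount d n = 0 := by
    by_contra h'
    obtain ⟨i, hi⟩ := eq_of_treeCount_ne_zero h'
    exact h i hi
  exact ⟨by rw [signedTreeCount, this, mul_zero], this⟩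

/-- A forest with `d * i + d + 1` leaves carries the sign `(-1) ^ i`. The new root is one more
internal vertex, which turns the plus sign in `treeCount_eq` into a minus. -/
theorem signedTreeCount_eq {d : ℕ} (hd : 1 ≤ d) : signedTreeCount d =
    Pi.single 1 1 - (blockConv (signedTreeCount d))^[d] (Pi.single 1 1) := by
  obtain ⟨h1, h2⟩ := iterate_blockConv_signed hd (signedTreeCount_mul_add_one hd)
    (fun n => signedTreeCount_eq_zero) d
  funext n
  have ht := congrFun (treeCount_eq d) n
  rw [Pi.add_apply] at ht
  rw [Pi.sub_apply]
  by_cases hn : ∃ i, n = d * i + d + 1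
  · obtain ⟨i, rfl⟩ := hn
    have h3 := signedTreeCount_mul_add_one hd (i + 1)
    rw [mul_add, mul_one] at h3
    rw [Pi.single_eq_of_ne (by omega), zero_add] at ht
    rw [h3, h1, ht, Pi.single_eq_of_ne (by omega), pow_succ]
    ring
  · obtain ⟨h3, h4⟩ := h2 n (not_exists.1 hn)
    rw [h4, add_zero] at ht
    rw [h3, sub_zero, signedTreeCount, ht]
    rcases eq_or_ne n 1 with rfl | hn1
    · simp
    · rw [Pi.single_eq_of_ne hn1, mul_zero]

end PlaneTree

/-! ### Goodness in terms of degrees -/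

namespace PlaneTree

theorem subtreeAt_nil (t : PlaneTree) : t.subtreeAt [] = some t := by
  cases t <;> rfl

theorem subtreeAt_append (t : PlaneTree) (p q : List ℕ) :
    t.subtreeAt (p ++ q) = (t.subtreeAt p).bind fun s => s.subtreeAt q := by
  induction p generalizing t with
  | nil => rw [subtreeAt_nil]; rfl
  | cons i p ih =>
    cases t with
    | leaf a => rfl
    | node k c =>
      rw [List.cons_append, subtreeAt, subtreeAt]
      split_ifs with h
      · exact ih _
      · rfl

theorem IsVertex.of_append {t : PlaneTree} {p q : List ℕ} (h : t.IsVertex (p ++ q)) :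
    t.IsVertex p := by
  rw [IsVertex, subtreeAt_append] at h
  exact Option.isSome_of_isSome_bind h

theorem IsVertex.degree_ne_zero {t : PlaneTree} {p : List ℕ} {i : ℕ}
    (h : t.IsVertex (p ++ [i])) : t.degree p ≠ 0 := by
  rw [IsVertex, subtreeAt_append] at h
  obtain ⟨s, hs⟩ := Option.isSome_iff_exists.1 (Option.isSome_of_isSome_bind h)
  rw [hs, Option.bind_some] at h
  rw [degree, hs]
  cases s with
  | leaf a => simp [subtreeAt] at h
  | node k c =>
    rw [subtreeAt] at h
    split_ifs at h with hi
    · simp only [Option.map_some, Option.getD_some, rootDegree]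
      omega
    · simp at h

theorem leftEndpoints_Ici_one : leftEndpoints (Set.Ici 1) = ∅ := by
  ext x
  simp only [leftEndpoints, Set.mem_Ici, Set.mem_ofPred_eq, Set.mem_empty_iff_false, iff_false]
  omega

theorem rightEndpoints_Ici_one : rightEndpoints (Set.Ici 1) = ∅ := by
  ext x
  simp only [rightEndpoints, Set.mem_Ici, Set.mem_ofPred_eq, Set.mem_empty_iff_false, iff_false]
  omega

/-- With no endpoints available, a vertex with left-odd ancestry must be a leaf. A left-most child
has such ancestry through the two-vertex path from its parent, provided the parent is not itself a
left-most child; by induction a parent of that kind would be a leaf. -/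
theorem isGood_Ici_one_iff (d : ℕ) (t : PlaneTree) :
    t.IsGood (Set.Ici 1) d ↔
      (∀ v, t.IsVertex v → t.degree v = d + 1 ∨ t.degree v = 0) ∧
        ∀ v, t.IsVertex (v ++ [0]) → t.degree (v ++ [0]) = 0 := by
  have hst : stretch d 2 = d + 1 := by simp [stretch]
  simp only [IsGood, leftEndpoints_Ici_one, rightEndpoints_Ici_one, Set.mem_empty_iff_false,
    false_and, exists_false, or_false, hst]
  constructor
  · intro h
    have hdeg : ∀ v, t.IsVertex v → t.degree v = d + 1 ∨ t.degree v = 0 := by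
      intro v hv
      by_cases hl : t.HasLeftOddAncestry (d + 1) v
      · exact Or.inr ((h v hv).2 hl)
      · exact ((h v hv).1 hl).symm
    refine ⟨hdeg, fun v => ?_⟩
    induction v using List.reverseRecOn with
    | nil =>
      intro hv
      refine (h _ hv).2 ⟨[], 2, by omega, even_two, rfl, ?_, fun w hw => by simp at hw⟩
      intro i hi
      obtain rfl : i = 0 := by omega
      exact (hdeg [] (IsVertex.of_append (p := []) hv)).resolve_right
        (IsVertex.degree_ne_zero (p := []) hv)
    | append_singleton w j ih =>
      intro hv
      refine (h _ hv).2 ⟨w ++ [j], 2, by omega, even_two, rfl, ?_, fun w' hw' => ?_⟩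
      · intro i hi
        obtain rfl : i = 0 := by omega
        simp only [List.replicate_zero, List.append_nil]
        exact (hdeg _ hv.of_append).resolve_right hv.degree_ne_zero
      · obtain ⟨rfl, hj⟩ := List.append_inj' hw' rfl
        obtain rfl : j = 0 := by simpa using hj
        exact absurd (ih hv.of_append) hv.degree_ne_zero
  · rintro ⟨h1, h2⟩ v hv
    refine ⟨fun _ => (h1 v hv).symm, ?_⟩
    rintro ⟨p, k, hk, he, rfl, -, -⟩
    -- An even `k ≥ 1` is at least 2, so the path takes a step and its end is a left-most child.
    obtain ⟨m, rfl⟩ : ∃ m, k = m + 2 := ⟨k - 2, by obtain ⟨r, rfl⟩ := he; omega⟩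
    have : p ++ List.replicate (m + 2 - 1) 0 = (p ++ List.replicate m 0) ++ [0] := by
      rw [List.append_assoc, ← List.replicate_succ']
      rfl
    rw [this] at hv ⊢
    exact h2 _ hv

theorem degree_node_cons {k : ℕ} (c : Fin k → PlaneTree) (i : Fin k) (p : List ℕ) :
    (node k c).degree (i.val :: p) = (c i).degree p := by
  rw [degree, subtreeAt, dif_pos i.2]
  rfl

theorem isVertex_node_cons {k : ℕ} (c : Fin k → PlaneTree) (i : Fin k) (p : List ℕ) :
    (node k c).IsVertex (i.val :: p) ↔ (c i).IsVertex p := by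
  rw [IsVertex, subtreeAt, dif_pos i.2]
  rfl

theorem IsVertex.exists_of_node_cons {k : ℕ} {c : Fin k → PlaneTree} {i : ℕ} {p : List ℕ}
    (h : (node k c).IsVertex (i :: p)) : ∃ j : Fin k, i = j := by
  rw [IsVertex, subtreeAt] at h
  split_ifs at h with hi
  · exact ⟨⟨i, hi⟩, rfl⟩
  · simp at h

theorem isVertex_nil (t : PlaneTree) : t.IsVertex [] := by
  rw [IsVertex, subtreeAt_nil]
  rfl

theorem degree_nil (t : PlaneTree) : t.degree [] = t.rootDegree := by
  rw [degree, subtreeAt_nil]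
  rfl

theorem LeftLeafy.noUnary {d : ℕ} (hd : 1 ≤ d) {t : PlaneTree} (h : t.LeftLeafy d) :
    t.NoUnary := by
  induction t with
  | leaf a => trivial
  | node k c ih =>
    obtain ⟨rfl, -, h⟩ := h
    exact ⟨by omega, fun i => ih i (h i)⟩

/-- `NoUnary` excludes `node 0 _`, so degree 0 really means a leaf. -/
theorem leftLeafy_of_degrees {d : ℕ} {t : PlaneTree} (hu : t.NoUnary)
    (h1 : ∀ v, t.IsVertex v → t.degree v = d + 1 ∨ t.degree v = 0)
    (h2 : ∀ v, t.IsVertex (v ++ [0]) → t.degree (v ++ [0]) = 0) : t.LeftLeafy d := by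
  induction t with
  | leaf a => trivial
  | node k c ih =>
    obtain ⟨hk, hu⟩ := hu
    have hk' : k = d + 1 := by
      have := h1 [] (isVertex_nil _)
      rw [degree_nil, rootDegree] at this
      omega
    refine ⟨hk', fun i hi => ?_, fun i => ih i (hu i) ?_ ?_⟩
    · have h3 : (node k c).IsVertex (i.val :: []) := (isVertex_node_cons c i []).2 (isVertex_nil _)
      have h4 := h2 [] (by rw [hi] at h3; exact h3)
      have h5 : (node k c).degree (i.val :: []) = 0 := by rw [hi]; exact h4
      rw [degree_node_cons, degree_nil] at h5
      have h6 := hu i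
      cases hci : c i with
      | leaf a => exact ⟨a, rfl⟩
      | node m e =>
        rw [hci] at h5 h6
        rw [rootDegree] at h5
        exact absurd h6.1 (by omega)
    · intro v hv
      rw [← degree_node_cons c i v]
      exact h1 _ ((isVertex_node_cons c i v).2 hv)
    · intro v hv
      rw [← degree_node_cons c i]
      exact h2 (i.val :: v) ((isVertex_node_cons c i _).2 hv)

theorem LeftLeafy.degree_eq {d : ℕ} {t : PlaneTree} (h : t.LeftLeafy d) (v : List ℕ)
    (hv : t.IsVertex v) : t.degree v = d + 1 ∨ t.degree v = 0 := by
  induction t generalizing v with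
  | leaf a => cases v <;> exact Or.inr rfl
  | node k c ih =>
    obtain ⟨rfl, -, h⟩ := h
    cases v with
    | nil => exact Or.inl rfl
    | cons i v =>
      obtain ⟨j, rfl⟩ := hv.exists_of_node_cons
      rw [degree_node_cons]
      exact ih j (h j) v ((isVertex_node_cons c j v).1 hv)

theorem LeftLeafy.degree_append_zero {d : ℕ} {t : PlaneTree} (h : t.LeftLeafy d) (v : List ℕ)
    (hv : t.IsVertex (v ++ [0])) : t.degree (v ++ [0]) = 0 := by
  induction t generalizing v with
  | leaf a => cases v <;> rfl
  | node k c ih =>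
    obtain ⟨rfl, h0, h⟩ := h
    cases v with
    | nil =>
      obtain ⟨a, ha⟩ := h0 0 rfl
      have := degree_node_cons c 0 []
      rw [ha] at this
      exact this
    | cons i v =>
      rw [List.cons_append] at hv ⊢
      obtain ⟨j, rfl⟩ := hv.exists_of_node_cons
      rw [degree_node_cons]
      exact ih j (h j) v ((isVertex_node_cons c j _).1 hv)

theorem isGood_increasingTrees {d : ℕ} (hd : 1 ≤ d) (N : ℕ) :
    {t ∈ increasingTrees N | t.IsGood (Set.Ici 1) d} = treesOn d (Finset.Icc 1 N) := by
  ext t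
  constructor
  · rintro ⟨⟨⟨hu, hl⟩, hi⟩, hg⟩
    rw [isGood_Ici_one_iff] at hg
    exact ⟨leftLeafy_of_degrees hu hg.1 hg.2, hi, hl⟩
  · rintro ⟨h, hi, hl⟩
    exact ⟨⟨⟨h.noUnary hd, hl⟩, hi⟩, (isGood_Ici_one_iff d t).2
      ⟨h.degree_eq, h.degree_append_zero⟩⟩

end PlaneTree

/-! ### The rank function -/

namespace Finpartition

variable {α : Type*} [DecidableEq α] {S : Finset α}

theorem card_parts_lt_of_lt {x y : Finpartition S} (h : x < y) : y.parts.card < x.parts.card := by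
  refine lt_of_le_of_ne (card_mono h.le) fun hc => h.not_ge ?_
  have hex : ∀ B ∈ y.parts, ∃ C ∈ x.parts, C ≤ B := fun B => exists_le_of_le h.le
  choose! g hg hgB using hex
  have hinj : Set.InjOn g y.parts := by
    intro B hB B' hB' he
    obtain ⟨a, ha⟩ := x.nonempty_of_mem_parts (hg B hB)
    exact y.eq_of_mem_parts hB hB' (hgB B hB ha) (hgB B' hB' (he ▸ ha))
  -- With equal block counts, the chosen blocks exhaust `x`, so each block of `y` contains only one
  -- block of `x` and equals it.
  have himg : y.parts.image g = x.parts := by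
    refine Finset.eq_of_subset_of_card_le (Finset.image_subset_iff.2 hg) ?_
    rw [Finset.card_image_of_injOn hinj, hc]
  intro B hB
  refine ⟨g B, hg B hB, fun a ha => ?_⟩
  obtain ⟨C, hC, haC⟩ := x.exists_mem (y.subset hB ha)
  obtain ⟨B', hB', rfl⟩ := Finset.mem_image.1 (himg ▸ hC)
  obtain rfl : B' = B := y.eq_of_mem_parts hB' hB (hgB B' hB' haC) ha
  exact haC

theorem disjoint_sup_sdiff (x : Finpartition S) {T : Finset (Finset α)} (hT : T ⊆ x.parts) :
    Disjoint ((x.parts \ T).sup id) (T.sup id) := by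
  rw [Finset.disjoint_left]
  intro a ha ha'
  simp only [Finset.mem_sup, id] at ha ha'
  obtain ⟨C, hC, ha⟩ := ha
  obtain ⟨C', hC', ha'⟩ := ha'
  rw [Finset.mem_sdiff] at hC
  exact hC.2 (x.eq_of_mem_parts hC.1 (hT hC') ha ha' ▸ hC')

/-- Merge a nonempty family of blocks into a single block. -/
def merge (x : Finpartition S) (T : Finset (Finset α)) (hT : T ⊆ x.parts) (hne : T.Nonempty) :
    Finpartition S :=
  (x.ofSubset (b := (x.parts \ T).sup id) Finset.sdiff_subset rfl).extend (b := T.sup id)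
    (by
      obtain ⟨C, hC⟩ := hne
      obtain ⟨a, ha⟩ := x.nonempty_of_mem_parts (hT hC)
      exact Finset.nonempty_iff_ne_empty.1 ⟨a, Finset.le_sup (f := id) hC ha⟩)
    (x.disjoint_sup_sdiff hT)
    (by rw [← Finset.sup_union, Finset.sdiff_union_of_subset hT, x.sup_parts])

theorem merge_parts (x : Finpartition S) (T : Finset (Finset α)) (hT : T ⊆ x.parts)
    (hne : T.Nonempty) : (x.merge T hT hne).parts = insert (T.sup id) (x.parts \ T) := rfl

theorem card_merge (x : Finpartition S) (T : Finset (Finset α)) (hT : T ⊆ x.parts)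
    (hne : T.Nonempty) : (x.merge T hT hne).parts.card + T.card = x.parts.card + 1 := by
  rw [merge, card_extend, ofSubset_parts, Finset.card_sdiff_of_subset hT]
  have := Finset.card_le_card hT
  omega

theorem le_merge (x : Finpartition S) (T : Finset (Finset α)) (hT : T ⊆ x.parts)
    (hne : T.Nonempty) : x ≤ x.merge T hT hne := by
  intro C hC
  rw [merge_parts]
  by_cases h : C ∈ T
  · exact ⟨_, Finset.mem_insert_self _ _, Finset.le_sup (f := id) h⟩
  · exact ⟨C, Finset.mem_insert_of_mem (Finset.mem_sdiff.2 ⟨hC, h⟩), le_rfl⟩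

theorem merge_le {x y : Finpartition S} (h : x ≤ y) {T : Finset (Finset α)} (hT : T ⊆ x.parts)
    (hne : T.Nonempty) {B : Finset α} (hB : B ∈ y.parts) (hTB : ∀ C ∈ T, C ⊆ B) :
    x.merge T hT hne ≤ y := by
  intro C hC
  rw [merge_parts, Finset.mem_insert] at hC
  rcases hC with rfl | hC
  · exact ⟨B, hB, Finset.sup_le hTB⟩
  · exact h (Finset.mem_sdiff.1 hC).1

end Finpartition

namespace OneModPartition

variable {d N : ℕ}

/-- A block of `y` that is not a block of `x` is a union of `x`-blocks whose number is 1 mod d and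
not 1, hence at least d + 1. Merging d + 1 of them keeps all sizes 1 mod d and stays below `y`. -/
theorem exists_merge (hd : 1 ≤ d) {x y : OneModPartition d N} (h : x < y) :
    ∃ z : OneModPartition d N, x < z ∧ z ≤ y ∧ z.1.parts.card + d = x.1.parts.card := by
  have hle : x.1 ≤ y.1 := h.le
  obtain ⟨B, hB, hBx⟩ : ∃ B ∈ y.1.parts, B ∉ x.1.parts := by
    by_contra! hcon
    exact h.not_ge fun B hB => ⟨B, hcon B hB, le_rfl⟩
  have hsup := Finpartition.sup_filter_subset hle hB
  set F := x.1.parts.filter (· ⊆ B) with hF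
  have hFx : F ⊆ x.1.parts := Finset.filter_subset _ _
  have hFmod : F.card ≡ 1 [MOD d] :=
    ((x.1.ofSubset hFx hsup).card_parts_modEq fun C hC => x.2 C (hFx hC)).trans (y.2 B hB)
  have hF0 : F.card ≠ 0 := by
    intro h0
    rw [Finset.card_eq_zero.1 h0, Finset.sup_empty] at hsup
    exact y.1.ne_bot hB hsup.symm
  have hF1 : F.card ≠ 1 := by
    intro h1
    obtain ⟨C, hC⟩ := Finset.card_eq_one.1 h1
    rw [hC, Finset.sup_singleton, id] at hsup
    exact hBx (hsup ▸ hFx (hC ▸ Finset.mem_singleton_self C))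
  have hFd : d + 1 ≤ F.card := by
    obtain ⟨j, hj⟩ := (Nat.modEq_iff_dvd' (by omega)).1 hFmod.symm
    have : j ≠ 0 := by
      rintro rfl
      omega
    have := Nat.le_mul_of_pos_right d (Nat.pos_of_ne_zero this)
    omega
  obtain ⟨T, hTF, hTc⟩ := Finset.exists_subset_card_eq hFd
  have hT : T ⊆ x.1.parts := hTF.trans hFx
  have hne : T.Nonempty := Finset.card_pos.1 (by omega)
  have hmod : (T.sup id).card ≡ 1 [MOD d] := by
    refine ((x.1.ofSubset hT rfl).card_parts_modEq fun C hC => x.2 C (hT hC)).symm.trans ?_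
    rw [Finpartition.ofSubset_parts, hTc]
    simp [Nat.ModEq]
  have hcard := x.1.card_merge T hT hne
  refine ⟨⟨x.1.merge T hT hne, fun C hC => ?_⟩, ?_, ?_, by dsimp only; omega⟩
  · rw [Finpartition.merge_parts, Finset.mem_insert] at hC
    rcases hC with rfl | hC
    · exact hmod
    · exact x.2 C (Finset.mem_sdiff.1 hC).1
  · refine lt_of_le_of_ne (x.1.le_merge T hT hne) fun he => ?_
    have he' : x.1 = x.1.merge T hT hne := congrArg Subtype.val he
    rw [← he'] at hcard
    omega
  · exact Finpartition.merge_le hle hT hne hB fun C hC => (Finset.mem_filter.1 (hTF hC)).2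

/-- The rank of a partition. -/
def rank (x : OneModPartition d N) : ℕ := (N - x.1.parts.card) / d

theorem card_parts_add_rank (x : OneModPartition d N) : x.1.parts.card + d * x.rank = N := by
  have h1 := x.1.card_parts_le_card
  have h2 := x.1.card_parts_modEq x.2
  rw [Nat.card_Icc, Nat.add_sub_cancel] at h1 h2
  rw [rank, Nat.mul_div_cancel' ((Nat.modEq_iff_dvd' h1).1 h2)]
  omega

theorem rank_strictMono : StrictMono (rank : OneModPartition d N → ℕ) := by
  intro x y h
  have h1 := Finpartition.card_parts_lt_of_lt (show x.1 < y.1 from h)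
  have h2 := x.card_parts_add_rank
  have h3 := y.card_parts_add_rank
  by_contra! h4
  have := Nat.mul_le_mul_left d h4
  omega

theorem exists_rank_eq_add_one (hd : 1 ≤ d) {x y : OneModPartition d N} (h : x < y) :
    ∃ z, x < z ∧ z ≤ y ∧ z.rank = x.rank + 1 := by
  obtain ⟨z, h1, h2, h3⟩ := exists_merge hd h
  have h4 := x.card_parts_add_rank
  have h5 := z.card_parts_add_rank
  refine ⟨z, h1, h2, Nat.eq_of_mul_eq_mul_left hd ?_⟩
  rw [mul_add]
  omega

theorem height_eq_rank (hd : 1 ≤ d) (x : OneModPartition d N) : Order.height x = x.rank := by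
  rw [Order.height_eq_of_strictMono rank rank_strictMono, Order.height_nat]
  intro a b hb
  -- Climbing from `⊥` towards `a` by single merges attains every intermediate rank.
  have key : ∀ b ≤ a.rank, ∃ a' ≤ a, a'.rank = b := by
    intro b
    induction b with
    | zero =>
      intro _
      refine ⟨⊥, bot_le, ?_⟩
      have h1 : (⊥ : OneModPartition d N).1.parts.card = N := by
        refine (Finpartition.card_bot (Finset.Icc 1 N)).trans ?_
        simp
      rw [rank, h1, Nat.sub_self, Nat.zero_div]
    | succ b ih =>
      intro hb
      obtain ⟨a', ha', hr⟩ := ih (by omega)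
      have : a' < a := lt_of_le_of_ne ha' fun h => by rw [h] at hr; omega
      obtain ⟨z, -, hz, hzr⟩ := exists_rank_eq_add_one hd this
      exact ⟨z, hz, by omega⟩
  obtain ⟨a', ha', hr⟩ := key b (le_of_lt hb)
  exact ⟨a', lt_of_le_of_ne ha' fun h => by rw [h] at hr; exact hb.ne hr.symm, hr⟩

theorem isRankedPoset (hd : 1 ≤ d) : IsRankedPoset (OneModPartition d N) := by
  intro x y h
  obtain ⟨z, h1, h2, h3⟩ := exists_rank_eq_add_one hd h.lt
  obtain rfl : z = y := h2.eq_of_not_lt (h.2 h1)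
  rw [height_eq_rank hd, height_eq_rank hd, h3]
  rfl

-- Rank `m` leaves (d m + 1) - d m = 1 block, so the Whitney number is the single value μ(⊥, top).
open Classical in
theorem whitneyFirst_top (hd : 1 ≤ d) {f : ℕ → ℚ} (hs : ∀ n, f n ≠ 0 → n ≡ 1 [MOD d])
    (hf0 : f 0 = 0) (hf : f = Pi.single 1 1 - (blockConv f)^[d] (Pi.single 1 1)) (m : ℕ) :
    (whitneyFirst (OneModPartition d (d * m + 1)) m : ℚ) = f (d * m + 1) := by
  have hne : Finset.Icc 1 (d * m + 1) ≠ ⊥ :=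
    Finset.nonempty_iff_ne_empty.1 (Finset.nonempty_Icc.2 (by omega))
  let top : OneModPartition d (d * m + 1) := ⟨Finpartition.indiscrete hne, fun B hB => by
    rw [Finpartition.indiscrete_parts, Finset.mem_singleton] at hB
    rw [hB]
    simp [Nat.ModEq]⟩
  have htop : ∀ x : OneModPartition d (d * m + 1), Order.height x = (m : ℕ∞) ↔ x = top := by
    intro x
    have h1 := x.card_parts_add_rank
    have h2 : x = top ↔ x.1.parts.card = 1 := by
      constructor
      · rintro rfl
        exact Finset.card_singleton _
      · intro h
        obtain ⟨B, hB⟩ := Finset.card_eq_one.1 h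
        have h3 := x.1.sup_parts
        rw [hB, Finset.sup_singleton, id] at h3
        refine Subtype.ext (Finpartition.ext ?_)
        rw [hB, h3]
        rfl
    rw [h2, height_eq_rank hd, Nat.cast_inj]
    constructor
    · intro h
      rw [h] at h1
      omega
    · intro h
      exact Nat.eq_of_mul_eq_mul_left hd (by omega)
  unfold whitneyFirst
  let _ : Fintype (OneModPartition d (d * m + 1)) := Fintype.ofFinite _
  let locFin : LocallyFiniteOrder (OneModPartition d (d * m + 1)) := Fintype.toLocallyFiniteOrder
  rw [Finset.sum_eq_single top]
  -- The instances are passed explicitly to match those inside `whitneyFirst`.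
  · refine (@mu_bot_eq d _ hd locFin (fun _ _ => Classical.propDecidable _) f hs hf0 hf top).trans
      ((Finset.prod_singleton _ _).trans ?_)
    simp
  · intro x hx hxt
    exact absurd ((htop x).1 (Finset.mem_filter.1 hx).2) hxt
  · intro h
    exact (h (Finset.mem_filter.2 ⟨Finset.mem_univ _, (htop top).2 rfl⟩)).elim

end OneModPartition

theorem egf_eq_expSeriesAlong {d : ℕ} (hd : 1 ≤ d) {f : ℕ → ℚ}
    (hf : ∀ n, (∀ i, n ≠ d * i + 1) → f n = 0) {h : ℕ → ℚ}
    (hfh : ∀ i, f (d * i + 1) = (-1) ^ i * h (i + 1)) :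
    egf f = expSeriesAlong d fun n => (-1) ^ (n - 1) * h n := by
  ext n
  by_cases hn : ∃ i, n = d * i + 1
  · obtain ⟨i, rfl⟩ := hn
    have := coeff_expSeriesAlong hd (fun n => (-1) ^ (n - 1) * h n) (Nat.le_add_left 1 i)
    rw [Nat.add_sub_cancel] at this
    rw [this, egf, PowerSeries.coeff_mk, hfh]
  · rw [coeff_expSeriesAlong_of_ne _ (not_exists.1 hn), egf, PowerSeries.coeff_mk,
      hf n (not_exists.1 hn), zero_div]

theorem corollary6p1 (d : ℕ) (hd : 1 ≤ d) :
    (∃! g : ℚ⟦X⟧, IsCompInverse (hyperbolicSeries d) g) ∧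
    ∀ g : ℚ⟦X⟧, IsCompInverse (hyperbolicSeries d) g →
      (∃ h : ℕ → ℚ, g = expSeriesAlong d fun n => (-1) ^ (n - 1) * h n) ∧
      ∀ h : ℕ → ℚ, (g = expSeriesAlong d fun n => (-1) ^ (n - 1) * h n) →
        ∀ n : ℕ, 1 ≤ n →
          -- (a) the increasingly ordered `ℕ(d)`-good trees
          ({t ∈ PlaneTree.increasingTrees (d * (n - 1) + 1) | t.IsGood (Set.Ici 1) d}.Finite ∧
            h n = ({t ∈ PlaneTree.increasingTrees (d * (n - 1) + 1) |
              t.IsGood (Set.Ici 1) d}.ncard : ℚ) ∧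
            ∀ t ∈ PlaneTree.increasingTrees (d * (n - 1) + 1),
              (t.IsGood (Set.Ici 1) d ↔
                (∀ v, t.IsVertex v → t.degree v = d + 1 ∨ t.degree v = 0) ∧
                ∀ v, t.IsVertex (v ++ [0]) → t.degree (v ++ [0]) = 0)) ∧
          -- (b) the Whitney numbers of the first kind
          (IsRankedPoset (OneModPartition d (d * (n - 1) + 1)) ∧
            (whitneyFirst (OneModPartition d (d * (n - 1) + 1)) (n - 1) : ℚ) =
              (-1) ^ (n - 1) * h n) := by
  have hzero := fun n (hn : ∀ i, n ≠ d * i + 1) => (PlaneTree.signedTreeCount_eq_zero hn).1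
  have hf0 : PlaneTree.signedTreeCount d 0 = 0 := hzero 0 fun i => by omega
  have hf := PlaneTree.signedTreeCount_eq hd
  have hs : ∀ n, PlaneTree.signedTreeCount d n ≠ 0 → n ≡ 1 [MOD d] := by
    intro n hn
    obtain ⟨i, rfl⟩ : ∃ i, n = d * i + 1 := by
      by_contra h
      exact hn (hzero n (not_exists.1 h))
    simp [Nat.ModEq]
  refine ⟨existsUnique_isCompInverse (constantCoeff_hyperbolicSeries d)
    (by rw [coeff_one_hyperbolicSeries hd]; exact isUnit_one), fun g hg => ?_⟩
  obtain rfl : egf (PlaneTree.signedTreeCount d) = g :=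
    eq_of_subst_eq_X hg (by rw [constantCoeff_egf, hf0]) (subst_egf_hyperbolicSeries hd hf0 hf)
  refine ⟨⟨fun n => PlaneTree.treeCount d (d * (n - 1) + 1), egf_eq_expSeriesAlong hd hzero
    (PlaneTree.signedTreeCount_mul_add_one hd)⟩, fun h hh n hn => ?_⟩
  -- Here `h` is arbitrary; comparing coefficients fixes `h n` for `n ≥ 1`, while `h 0` stays free.
  have hcoeff := coeff_expSeriesAlong hd (fun n => (-1) ^ (n - 1) * h n) hn
  rw [← hh, egf, PowerSeries.coeff_mk, div_left_inj' (by positivity)] at hcoeff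
  have hh' : h n = PlaneTree.treeCount d (d * (n - 1) + 1) := by
    rw [PlaneTree.signedTreeCount_mul_add_one hd] at hcoeff
    exact (mul_left_cancel₀ (pow_ne_zero _ (by norm_num)) hcoeff).symm
  rw [PlaneTree.isGood_increasingTrees hd]
  refine ⟨⟨(PlaneTree.card_treesOn d _).1, hh', fun t _ => PlaneTree.isGood_Ici_one_iff d t⟩,
    OneModPartition.isRankedPoset hd, ?_⟩
  rw [OneModPartition.whitneyFirst_top hd hs hf0 hf, hcoeff]
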